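/- Let $\Bbbk$ be a field of characteristic $p>0$, let $V$ be a vector space with basis $x_1,x_2$ and braiding $c(x_i\otimes x_j)=q_{ij}\,x_j\otimes x_i$ with all $q_{ij}\in\Bbbk^\times$, and put $q=q_{11}$, $r=q_{12}q_{21}$, $s=q_{22}$. Grade the tensor algebra $T(V)$ by $\deg x_i=\alpha_i\in\mathbb Z^2$, let $\chi$ be the bicharacter of $\mathbb Z^2$ with $\chi(\alpha_i,\alpha_j)=q_{ij}$, and let $\pi:T(V)\to\mathcal B(V)$ be the canonical map onto the Nichols algebra. Let $d_1$ be the skew-derivation of $T(V)$ with $d_1(x_j)=\delta_{1j}$ and $d_1(yz)=d_1(y)z+\chi(\deg y,\alpha_1)\,y\,d_1(z)$, and let $(\mathrm{ad}\,x_1)(y)=x_1y-\chi(\alpha_1,\deg y)\,yx_1$, for homogeneous $y$. Write $(k)_t=1+t+\dots+t^{k-1}$, $(k)_q^!=\prod_{i=1}^k(i)_q$ and $b_k=\prod_{i=0}^{k-1}(1-q^ir)$. Let $u_0=x_2$, $u_k=x_1u_{k-1}-q^{k-1}q_{12}u_{k-1}x_1$ for $k\ge1$, and $U'_k=\bigoplus_{i=0}^{k-1}\Bbbk\,u_iu_{k-i}\subseteq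 T(V)$. For $(k)_q^!b_k\ne0$ let $\hat u_k=\frac{1}{(k)_q^!b_k}u_k$ and $P_k=\sum_{i=0}^k(-q_{21})^iq^{i(i-1)/2}\,\hat u_i\hat u_{k-i}$. Define $\mathbb J\subseteq\mathbb N_0$ recursively: $j\in\mathbb J$ if and only if $q^{j(j-1)/2}(-r)^js=-1$ and, for all $n\in\mathbb J$ with $n<j$, $\left(\frac{j-n}{2}\right)_{q^{n+j-1}r^2}=0$ if $j-n$ is even and $(j-n)_{-q^{(n+j-1)/2}r}=0$ if $j-n$ is odd. Let $\mathbb J_1$ be the set of all $j\in\mathbb J$ such that $q^{n+j-1}r^2\ne1$ for all $n\in\mathbb J$ with $n<j$. Let $\mathbb J_2$ be the set of all $j\in\mathbb J$ for which there is $n\in\mathbb J$ with $n<j$ such that $q^{n+j-1}r^2=1$ and $2p\mid j-n$ if $j-n$ is even, and $q^{(n+j-1)/2}r=-1$ and $p\mid j-n$ if $j-n$ is odd. Let $n\in\mathbb J_2$ with $(n)_q^!b_n\neq0$, and let $j_n\in\mathbb J_1$ with $j_n<n$ and $q^{n+j_n-1}r^2=1$. Then there exists a unique element $L_n\in U'_n\cap\ker(\pi)$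 such that $$-q_{21}^{-1}d_1(L_n)=(\mathrm{ad}\,x_1)^{n-j_n-1}(P_{j_n}).$$ -/

import Mathlib

open scoped TensorProduct

noncomputable section

namespace RankTwo

/-! ### The tensor algebra of a rank two braided vector space of diagonal type

`V` is the vector space with basis `x₁, x₂`, the braiding is
`c (xᵢ ⊗ xⱼ) = Q i j • xⱼ ⊗ xᵢ`, and the indices `1, 2` are the elements `0, 1` of `Fin 2`. -/

section TensorAlgebra

variable {k : Type*} [Field k]

/-- The tensor algebra `T(V)` of `V = k x₁ ⊕ k x₂`, i.e. the free algebra on `x₁, x₂`. -/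
abbrev T (k : Type*) [Field k] : Type _ := FreeAlgebra k (Fin 2)

/-- The generators `x₁ = x 0` and `x₂ = x 1` of `T(V)`. -/
abbrev x (i : Fin 2) : T k := FreeAlgebra.ι k i

/-- The component of `T(V)` of degree `m`, spanned by the words of length `m`. -/
def degPart (k : Type*) [Field k] (m : ℕ) : Submodule k (T k) :=
  Submodule.span k (Set.range fun w : Fin m → Fin 2 => (List.ofFn fun a => x (k := k) (w a)).prod)

/-- `y ↦ χ(αᵢ, deg y) y` on homogeneous `y`: the algebra map with `xⱼ ↦ Q i j • xⱼ`. -/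
def twistL (Q : Matrix (Fin 2) (Fin 2) k) (i : Fin 2) : T k →ₐ[k] T k :=
  FreeAlgebra.lift k fun j => Q i j • x j

/-- `y ↦ χ(deg y, αᵢ) y` on homogeneous `y`: the algebra map with `xⱼ ↦ Q j i • xⱼ`. -/
def twistR (Q : Matrix (Fin 2) (Fin 2) k) (i : Fin 2) : T k →ₐ[k] T k :=
  FreeAlgebra.lift k fun j => Q j i • x j

/-- The left action of `T(V)` on `T(V) ⊗ T(V)` in which `xᵢ` acts by left multiplication with
`xᵢ ⊗ 1 + 1 ⊗ xᵢ`, for the product `(a ⊗ b) (a' ⊗ b') = a c(b ⊗ a') b'` of the braided tensor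
square: `(xᵢ ⊗ 1) (a ⊗ b) = xᵢ a ⊗ b` and `(1 ⊗ xᵢ) (a ⊗ b) = χ(αᵢ, deg a) a ⊗ xᵢ b`. -/
def coprodAction (Q : Matrix (Fin 2) (Fin 2) k) : T k →ₐ[k] Module.End k (T k ⊗[k] T k) :=
  FreeAlgebra.lift k fun i =>
    TensorProduct.map (LinearMap.mulLeft k (x i)) LinearMap.id +
      TensorProduct.map (twistL Q i).toLinearMap (LinearMap.mulLeft k (x i))

/-- The coproduct `Δ` of the braided bialgebra `T(V)`: the algebra map from `T(V)` to the braided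
tensor square with `Δ(xᵢ) = xᵢ ⊗ 1 + 1 ⊗ xᵢ`. -/
def coprod (Q : Matrix (Fin 2) (Fin 2) k) : T k →ₗ[k] T k ⊗[k] T k :=
  (LinearMap.applyₗ (1 ⊗ₜ[k] 1)).comp (coprodAction Q).toLinearMap

/-- The two-sided ideals `I` of `T(V)` that are spanned by homogeneous elements of degree at
least `2` and are coideals: `Δ(I) ⊆ I ⊗ T(V) + T(V) ⊗ I`. -/
structure IsGradedCoideal (Q : Matrix (Fin 2) (Fin 2) k) (I : TwoSidedIdeal (T k)) : Prop where
  homogeneous : ∀ y ∈ I,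
    y ∈ Submodule.span k {z : T k | z ∈ I ∧ ∃ m : ℕ, 2 ≤ m ∧ z ∈ degPart k m}
  coideal : ∀ y ∈ I,
    coprod Q y ∈ Submodule.span k {t : T k ⊗[k] T k | ∃ a ∈ I, ∃ b : T k, t = a ⊗ₜ b ∨ t = b ⊗ₜ a}

/-- The defining ideal of the Nichols algebra: the largest (i.e. the sum) of all coideals as
above. -/
def nicholsIdeal (Q : Matrix (Fin 2) (Fin 2) k) : TwoSidedIdeal (T k) :=
  sSup {I | IsGradedCoideal Q I}

/-- The Nichols algebra `B(V)`. -/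
abbrev NicholsAlgebra (Q : Matrix (Fin 2) (Fin 2) k) : Type _ := (nicholsIdeal Q).ringCon.Quotient

/-- The canonical map `π : T(V) → B(V)`. -/
def nicholsMap (Q : Matrix (Fin 2) (Fin 2) k) : T k →ₐ[k] NicholsAlgebra Q :=
  (nicholsIdeal Q).ringCon.mkₐ (α := k)

/-- The algebra map `y ↦ [[χ(deg y, αᵢ) y, dᵢ(y)], [0, y]]` that defines `dᵢ`. -/
def skewDerMatrix (Q : Matrix (Fin 2) (Fin 2) k) (i : Fin 2) :
    T k →ₐ[k] Matrix (Fin 2) (Fin 2) (T k) :=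
  FreeAlgebra.lift k fun j => !![Q j i • x j, if i = j then 1 else 0; 0, x j]

/-- The skew-derivation `dᵢ` of `T(V)`: `dᵢ(xⱼ) = δᵢⱼ` and
`dᵢ(y z) = dᵢ(y) z + χ(deg y, αᵢ) y dᵢ(z)`; see `skewDer_x` and `skewDer_mul`. -/
def skewDer (Q : Matrix (Fin 2) (Fin 2) k) (i : Fin 2) : T k →ₗ[k] T k :=
  (Matrix.entryLinearMap k (T k) 0 1).comp (skewDerMatrix Q i).toLinearMap

/-- The adjoint action of `xᵢ`: `y ↦ xᵢ y - χ(αᵢ, deg y) y xᵢ` on homogeneous `y`. -/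
def adx (Q : Matrix (Fin 2) (Fin 2) k) (i : Fin 2) : T k →ₗ[k] T k :=
  LinearMap.mulLeft k (x i) - (LinearMap.mulRight k (x i)).comp (twistL Q i).toLinearMap

theorem skewDer_x (Q : Matrix (Fin 2) (Fin 2) k) (i j : Fin 2) :
    skewDer Q i (x j) = if i = j then 1 else 0 := by
  simp [skewDer, skewDerMatrix]

theorem skewDerMatrix_eq (Q : Matrix (Fin 2) (Fin 2) k) (i : Fin 2) (y : T k) :
    skewDerMatrix Q i y = !![twistR Q i y, skewDer Q i y; 0, y] := by
  have h00 : ∀ y : T k, skewDerMatrix Q i y 0 0 = twistR Q i y ∧ skewDerMatrix Q i y 1 0 = 0 ∧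
      skewDerMatrix Q i y 1 1 = y := by
    intro y
    induction y using FreeAlgebra.induction with
    | grade0 r => simp [Matrix.algebraMap_matrix_apply]
    | grade1 j => simp [skewDerMatrix, twistR]
    | mul a b ha hb => simp [Matrix.mul_apply, Fin.sum_univ_two, ha, hb]
    | add a b ha hb => simp [ha, hb]
  obtain ⟨h1, h2, h3⟩ := h00 y
  ext a b
  fin_cases a <;> fin_cases b <;> simp [h1, h2, h3, skewDer]

theorem skewDer_mul (Q : Matrix (Fin 2) (Fin 2) k) (i : Fin 2) (y z : T k) :
    skewDer Q i (y * z) = skewDer Q i y * z + twistR Q i y * skewDer Q i z := by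
  have h : skewDer Q i (y * z) = skewDerMatrix Q i (y * z) 0 1 := rfl
  rw [h, map_mul, skewDerMatrix_eq, skewDerMatrix_eq]
  simp [Matrix.mul_apply, Fin.sum_univ_two, add_comm]

end TensorAlgebra

/-! ### Quantum numbers and the elements `u_n`, `P_n` -/

section Elements

variable {k : Type*} [Field k]

/-- `(n)_q = 1 + q + ⋯ + q ^ (n - 1)`. -/
def qNum (q : k) (n : ℕ) : k := ∑ i ∈ Finset.range n, q ^ i

/-- `(n)_q^! = (1)_q (2)_q ⋯ (n)_q`. -/
def qFact (q : k) (n : ℕ) : k := ∏ i ∈ Finset.range n, qNum q (i + 1)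

/-- `b_n = ∏_{j < n} (1 - q ^ j r)`. -/
def bProd (q r : k) (n : ℕ) : k := ∏ j ∈ Finset.range n, (1 - q ^ j * r)

/-- `u_0 = x₂` and `u_{n+1} = x₁ u_n - q ^ n q₁₂ u_n x₁`, where `q = q₁₁`. -/
def u (Q : Matrix (Fin 2) (Fin 2) k) : ℕ → T k
  | 0 => x 1
  | n + 1 => x 0 * u Q n - (Q 0 0 ^ n * Q 0 1) • (u Q n * x 0)

/-- `u_n / ((n)_q^! b_n)` with `q = q₁₁`, `r = q₁₂ q₂₁`, and `0` if the denominator vanishes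
(in `k`, the inverse of `0` is `0`). -/
def uHat (Q : Matrix (Fin 2) (Fin 2) k) (n : ℕ) : T k :=
  (qFact (Q 0 0) n * bProd (Q 0 0) (Q 0 1 * Q 1 0) n)⁻¹ • u Q n

/-- `U'_n`, the span of the `u_i u_{n-i}` with `0 ≤ i ≤ n - 1`. -/
def U' (Q : Matrix (Fin 2) (Fin 2) k) (n : ℕ) : Submodule k (T k) :=
  Submodule.span k {y | ∃ i < n, y = u Q i * u Q (n - i)}

/-- `P_n = ∑_{i=0}^n (-q₂₁)^i q^{i(i-1)/2} û_i û_{n-i}`. -/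
def P (Q : Matrix (Fin 2) (Fin 2) k) (n : ℕ) : T k :=
  ∑ i ∈ Finset.range (n + 1),
    ((-Q 1 0) ^ i * Q 0 0 ^ (i * (i - 1) / 2)) • (uHat Q i * uHat Q (n - i))

end Elements

/-! ### The sets `J`, `J₁`, `J₂` -/

section Sets

variable {k : Type*} [Field k]

/-- The membership predicate of `J`, by recursion on `j`. All natural number divisions by `2` are
exact, and `j ≥ 1` wherever `n + j - 1` occurs. -/
def InJ (q r s : k) (j : ℕ) : Prop :=
  q ^ (j * (j - 1) / 2) * (-r) ^ j * s = -1 ∧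
    ∀ n, n < j → InJ q r s n →
      (Even (j - n) → qNum (q ^ (n + j - 1) * r ^ 2) ((j - n) / 2) = 0) ∧
      (Odd (j - n) → qNum (-(q ^ ((n + j - 1) / 2) * r)) (j - n) = 0)
termination_by j

/-- The set `J`. -/
def J (q r s : k) : Set ℕ := {j | InJ q r s j}

/-- The set `J₁` of the `j ∈ J` with `q ^ (n + j - 1) r² ≠ 1` for all `n ∈ J`, `n < j`. -/
def J₁ (q r s : k) : Set ℕ :=
  {j | j ∈ J q r s ∧ q ^ (j * (j - 1) / 2) * (-r) ^ j * s = -1 ∧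
    ∀ n ∈ J q r s, n < j → q ^ (n + j - 1) * r ^ 2 ≠ 1}

/-- The set `J₂` in characteristic `p`. -/
def J₂ (p : ℕ) (q r s : k) : Set ℕ :=
  {j | j ∈ J q r s ∧ ∃ n ∈ J q r s, n < j ∧
    (Even (j - n) → q ^ (n + j - 1) * r ^ 2 = 1 ∧ 2 * p ∣ j - n) ∧
    (Odd (j - n) → q ^ ((n + j - 1) / 2) * r = -1 ∧ p ∣ j - n)}

end Sets

end RankTwo

end

/-! Write `n = j + t + 1` and `y = (ad x₁)^t(P_j)`. An element of the span of the `û_m û_{n-m}` is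
given by its coefficients `a_m`. On these, `d₁` acts by `a ↦ a_{m+1} + q^m q₂₁ a_m`, while `d₂`
keeps only the two end coefficients, giving a multiple of `û_n`. Uniqueness: `a_n = 0` on `U'_n`, so
`d₁(L)` determines the remaining coefficients by downward recursion. Existence: solve `d₁(L) = -q₂₁
y` upward from `a_0 = 0`. By telescoping, `a_n = 0` exactly when a weighted sum of the coefficients
of `y` vanishes (`exists_mem_U'`). Then `L ∈ U'_n` and `d₂(L) = 0`. The relation `d₁(P_j) = d₂(P_j)
= 0` puts `P_j`, hence `y` and `d₁(L)`, in the radical of the functionals `pairing`. So `L` lies in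
the radical, which is contained in the kernel of `π` (`isGradedCoideal_radical`). The weighted sum
vanishes because `d₁((ad x₁)^{t+1}(P_j)) = (t+1)_q (1 - q^{2j+t} r²) y` (`derCoeff_adCoeff_succ`),
so that telescoping evaluates the sum times this scalar. The scalar is zero when `q^{n+j-1} r² = 1`.
Therefore `q₁₂` is replaced by an indeterminate and the offending factor is cancelled; the quotient
contains the quantum number that vanishes by the definition of `J` (`sum_mul_adCoeff_eq_zero`). -/

noncomputable section

namespace RankTwo

/-! ### The radical of the skew-derivations as a two-sided ideal. -/

section Radical

variable {k : Type*} [Field k]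

/-- The algebra endomorphism of `T(V)` that scales `xⱼ` by `c j`. -/
def scale (c : Fin 2 → k) : T k →ₐ[k] T k :=
  FreeAlgebra.lift k fun j => c j • x j

theorem twistL_eq_scale (Q : Matrix (Fin 2) (Fin 2) k) (i : Fin 2) :
    twistL Q i = scale (Q i) := rfl

theorem twistR_eq_scale (Q : Matrix (Fin 2) (Fin 2) k) (i : Fin 2) :
    twistR Q i = scale fun j => Q j i := rfl

@[simp]
theorem scale_x (c : Fin 2 → k) (j : Fin 2) : scale c (x j) = c j • x j := by
  simp [scale]

theorem scale_scale (c d : Fin 2 → k) (y : T k) : scale c (scale d y) = scale d (scale c y) := by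
  have h : (scale c).comp (scale d) = (scale d).comp (scale c) := by
    ext j
    simp [smul_smul, mul_comm]
  exact DFunLike.congr_fun h y

theorem skewDer_algebraMap (Q : Matrix (Fin 2) (Fin 2) k) (i : Fin 2) (a : k) :
    skewDer Q i (algebraMap k (T k) a) = 0 := by
  simp [skewDer, Matrix.algebraMap_matrix_apply]

@[simp]
theorem skewDer_one (Q : Matrix (Fin 2) (Fin 2) k) (i : Fin 2) : skewDer Q i 1 = 0 := by
  simpa using skewDer_algebraMap Q i 1

theorem skewDer_x_mul (Q : Matrix (Fin 2) (Fin 2) k) (i j : Fin 2) (y : T k) :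
    skewDer Q i (x j * y) = (if i = j then y else 0) + Q j i • (x j * skewDer Q i y) := by
  rw [skewDer_mul, skewDer_x, twistR_eq_scale, scale_x]
  split_ifs <;> simp

theorem skewDer_scale (Q : Matrix (Fin 2) (Fin 2) k) (i : Fin 2) (c : Fin 2 → k) (y : T k) :
    skewDer Q i (scale c y) = c i • scale c (skewDer Q i y) := by
  induction y using FreeAlgebra.induction with
  | grade0 a => simp [skewDer_algebraMap]
  | grade1 j =>
    rw [scale_x, map_smul, skewDer_x]
    split_ifs with h <;> simp [h]
  | mul a b ha hb =>
    rw [map_mul, skewDer_mul, skewDer_mul, ha, hb, twistR_eq_scale, scale_scale]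
    simp [smul_add]
  | add a b ha hb => simp [ha, hb]

/-- Induction on `T(V)` by left multiplication with the generators. -/
theorem induction_left {p : T k → Prop} (one : p 1) (add : ∀ y z, p y → p z → p (y + z))
    (smul : ∀ (a : k) y, p y → p (a • y)) (x_mul : ∀ j y, p y → p (x j * y)) (y : T k) : p y := by
  have h : ∀ a y : T k, p y → p (a * y) := by
    intro a
    induction a using FreeAlgebra.induction with
    | grade0 c => intro y hy; rw [← Algebra.smul_def]; exact smul c y hy
    | grade1 j => exact x_mul j
    | mul a b ha hb => intro y hy; rw [mul_assoc]; exact ha _ (hb _ hy)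
    | add a b ha hb => intro y hy; rw [add_mul]; exact add _ _ (ha _ hy) (hb _ hy)
  simpa using h y 1 one

/-- The functionals `ε ∘ d_{i_m} ∘ ⋯ ∘ d_{i_1}` on `T(V)`, where `ε` is the counit. -/
def pairing (Q : Matrix (Fin 2) (Fin 2) k) : List (Fin 2) → T k →ₗ[k] k
  | [] => (FreeAlgebra.algebraMapInv (R := k) (X := Fin 2)).toLinearMap
  | i :: w => (pairing Q w).comp (skewDer Q i)

@[simp]
theorem pairing_cons (Q : Matrix (Fin 2) (Fin 2) k) (i : Fin 2) (w : List (Fin 2)) (y : T k) :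
    pairing Q (i :: w) y = pairing Q w (skewDer Q i y) := rfl

@[simp]
theorem pairing_nil_one (Q : Matrix (Fin 2) (Fin 2) k) : pairing Q [] 1 = 1 := by
  simp [pairing]

@[simp]
theorem pairing_nil_mul (Q : Matrix (Fin 2) (Fin 2) k) (y z : T k) :
    pairing Q [] (y * z) = pairing Q [] y * pairing Q [] z := by
  simp [pairing]

@[simp]
theorem pairing_nil_x (Q : Matrix (Fin 2) (Fin 2) k) (j : Fin 2) : pairing Q [] (x j) = 0 := by
  simp [pairing, FreeAlgebra.algebraMapInv]

theorem pairing_nil_scale (Q : Matrix (Fin 2) (Fin 2) k) (c : Fin 2 → k) (y : T k) :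
    pairing Q [] (scale c y) = pairing Q [] y := by
  have h : (FreeAlgebra.algebraMapInv (R := k) (X := Fin 2)).comp (scale c) =
      FreeAlgebra.algebraMapInv := by
    ext j
    simp [FreeAlgebra.algebraMapInv]
  exact DFunLike.congr_fun h y

/-- The common kernel of the functionals `pairing Q w`. -/
def radicalSubmodule (Q : Matrix (Fin 2) (Fin 2) k) : Submodule k (T k) :=
  ⨅ w, LinearMap.ker (pairing Q w)

theorem mem_radicalSubmodule {Q : Matrix (Fin 2) (Fin 2) k} {y : T k} :
    y ∈ radicalSubmodule Q ↔ ∀ w, pairing Q w y = 0 := by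
  simp [radicalSubmodule]

/-- Split off the first letter of the word. This reduces membership to the two skew-derivatives,
which have lower degree. -/
theorem mem_radicalSubmodule_iff_skewDer {Q : Matrix (Fin 2) (Fin 2) k} {y : T k} :
    y ∈ radicalSubmodule Q ↔
      pairing Q [] y = 0 ∧ ∀ i, skewDer Q i y ∈ radicalSubmodule Q := by
  simp only [mem_radicalSubmodule]
  refine ⟨fun h => ⟨h [], fun i w => h (i :: w)⟩, fun h w => ?_⟩
  cases w with
  | nil => exact h.1
  | cons i w => exact h.2 i w

theorem skewDer_mem_radicalSubmodule {Q : Matrix (Fin 2) (Fin 2) k} {y : T k}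
    (hy : y ∈ radicalSubmodule Q) (i : Fin 2) : skewDer Q i y ∈ radicalSubmodule Q :=
  (mem_radicalSubmodule_iff_skewDer.1 hy).2 i

theorem scale_mem_radicalSubmodule {Q : Matrix (Fin 2) (Fin 2) k} (c : Fin 2 → k) {y : T k}
    (hy : y ∈ radicalSubmodule Q) : scale c y ∈ radicalSubmodule Q := by
  rw [mem_radicalSubmodule]
  intro w
  induction w generalizing y with
  | nil => rw [pairing_nil_scale]; exact mem_radicalSubmodule.1 hy []
  | cons i w ih =>
    rw [pairing_cons, skewDer_scale, map_smul, ih (skewDer_mem_radicalSubmodule hy i), smul_zero]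

theorem x_mul_mem_radicalSubmodule {Q : Matrix (Fin 2) (Fin 2) k} (j : Fin 2) {y : T k}
    (hy : y ∈ radicalSubmodule Q) : x j * y ∈ radicalSubmodule Q := by
  rw [mem_radicalSubmodule]
  intro w
  induction w generalizing y with
  | nil => simp
  | cons i w ih =>
    rw [pairing_cons, skewDer_x_mul, map_add, map_smul, ih (skewDer_mem_radicalSubmodule hy i)]
    split_ifs <;> simp [mem_radicalSubmodule.1 hy w]

theorem mul_x_mem_radicalSubmodule {Q : Matrix (Fin 2) (Fin 2) k} (j : Fin 2) {y : T k}
    (hy : y ∈ radicalSubmodule Q) : y * x j ∈ radicalSubmodule Q := by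
  rw [mem_radicalSubmodule]
  intro w
  induction w generalizing y with
  | nil => simp
  | cons i w ih =>
    rw [pairing_cons, skewDer_mul, map_add, ih (skewDer_mem_radicalSubmodule hy i), skewDer_x,
      twistR_eq_scale]
    split_ifs <;> simp [mem_radicalSubmodule.1 (scale_mem_radicalSubmodule _ hy) w]

theorem mul_mem_radicalSubmodule {Q : Matrix (Fin 2) (Fin 2) k} (a : T k) {y : T k}
    (hy : y ∈ radicalSubmodule Q) : a * y ∈ radicalSubmodule Q ∧ y * a ∈ radicalSubmodule Q := by
  induction a using FreeAlgebra.induction generalizing y with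
  | grade0 c =>
    rw [← Algebra.commutes, ← Algebra.smul_def]
    exact ⟨Submodule.smul_mem _ c hy, Submodule.smul_mem _ c hy⟩
  | grade1 j => exact ⟨x_mul_mem_radicalSubmodule j hy, mul_x_mem_radicalSubmodule j hy⟩
  | mul a b ha hb =>
    rw [mul_assoc, ← mul_assoc y]
    exact ⟨(ha (hb hy).1).1, (hb (ha hy).2).2⟩
  | add a b ha hb =>
    rw [add_mul, mul_add]
    exact ⟨Submodule.add_mem _ (ha hy).1 (hb hy).1, Submodule.add_mem _ (ha hy).2 (hb hy).2⟩

/-- The common kernel of the functionals `pairing Q w`, as a two-sided ideal. -/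
def radical (Q : Matrix (Fin 2) (Fin 2) k) : TwoSidedIdeal (T k) :=
  TwoSidedIdeal.mk' (radicalSubmodule Q) (Submodule.zero_mem _) (Submodule.add_mem _)
    (Submodule.neg_mem _) (fun hy => (mul_mem_radicalSubmodule _ hy).1)
    (fun hy => (mul_mem_radicalSubmodule _ hy).2)

theorem mem_radical {Q : Matrix (Fin 2) (Fin 2) k} {y : T k} :
    y ∈ radical Q ↔ y ∈ radicalSubmodule Q := by
  simp [radical]

/-! ### Compatibility of the skew-derivations with the coproduct. -/

theorem coprod_x_mul (Q : Matrix (Fin 2) (Fin 2) k) (j : Fin 2) (y : T k) :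
    coprod Q (x j * y) = TensorProduct.map (LinearMap.mulLeft k (x j)) LinearMap.id (coprod Q y) +
      TensorProduct.map (twistL Q j).toLinearMap (LinearMap.mulLeft k (x j)) (coprod Q y) := by
  simp [coprod, coprodAction]

/-- Both sides obey the same recursion under left multiplication by `x j`; the twist on the left
factor commutes with `dᵢ` up to the scalar `Q j i`. -/
theorem rTensor_skewDer_coprod (Q : Matrix (Fin 2) (Fin 2) k) (i : Fin 2) (y : T k) :
    (skewDer Q i).rTensor (T k) (coprod Q y) = coprod Q (skewDer Q i y) := by
  induction y using induction_left with
  | one => simp [coprod]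
  | add y z hy hz => simp only [map_add, hy, hz]
  | smul a y hy => simp only [map_smul, hy]
  | x_mul j y hy =>
    have h : ∀ t : T k ⊗[k] T k,
        (skewDer Q i).rTensor (T k)
          (TensorProduct.map (LinearMap.mulLeft k (x j)) LinearMap.id t +
            TensorProduct.map (twistL Q j).toLinearMap (LinearMap.mulLeft k (x j)) t) =
        (if i = j then t else 0) + Q j i •
          (TensorProduct.map (LinearMap.mulLeft k (x j)) LinearMap.id
              ((skewDer Q i).rTensor (T k) t) +
            TensorProduct.map (twistL Q j).toLinearMap (LinearMap.mulLeft k (x j))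
              ((skewDer Q i).rTensor (T k) t)) := by
      intro t
      induction t with
      | zero => simp
      | tmul a b =>
        simp only [TensorProduct.map_tmul, map_add, LinearMap.rTensor_tmul,
          LinearMap.mulLeft_apply, skewDer_x_mul, LinearMap.id_apply, AlgHom.toLinearMap_apply,
          twistL_eq_scale, skewDer_scale, TensorProduct.add_tmul, TensorProduct.smul_tmul',
          smul_add]
        split_ifs <;> simp [add_assoc]
      | add a b ha hb =>
        simp only [map_add] at ha hb ⊢
        rw [add_add_add_comm, ha, hb]
        split_ifs <;> simp only [smul_add] <;> abel
    rw [coprod_x_mul, h, hy, skewDer_x_mul, map_add, map_smul, coprod_x_mul]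
    split_ifs <;> simp

theorem rTensor_counit_coprod (Q : Matrix (Fin 2) (Fin 2) k) (y : T k) :
    TensorProduct.lid k (T k) ((pairing Q []).rTensor (T k) (coprod Q y)) = y := by
  induction y using induction_left with
  | one => simp [coprod]
  | add y z hy hz => simp only [map_add, hy, hz]
  | smul a y hy => simp only [map_smul, hy]
  | x_mul j y hy =>
    have h : ∀ t : T k ⊗[k] T k,
        TensorProduct.lid k (T k) ((pairing Q []).rTensor (T k)
          (TensorProduct.map (LinearMap.mulLeft k (x j)) LinearMap.id t +
            TensorProduct.map (twistL Q j).toLinearMap (LinearMap.mulLeft k (x j)) t)) =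
        x j * TensorProduct.lid k (T k) ((pairing Q []).rTensor (T k) t) := by
      intro t
      induction t with
      | zero => simp
      | tmul a b => simp [twistL_eq_scale, pairing_nil_scale]
      | add a b ha hb =>
        simp only [map_add, mul_add] at ha hb ⊢
        rw [add_add_add_comm, ha, hb]
    rw [coprod_x_mul, h, hy]

/-- Contracting the left factor of `Δ(y)` with a functional amounts to applying the skew-derivations
of the word to `y`, and these preserve the radical. -/
theorem rTensor_pairing_coprod_mem {Q : Matrix (Fin 2) (Fin 2) k} (w : List (Fin 2)) {y : T k}
    (hy : y ∈ radicalSubmodule Q) :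
    TensorProduct.lid k (T k) ((pairing Q w).rTensor (T k) (coprod Q y)) ∈ radicalSubmodule Q := by
  induction w generalizing y with
  | nil => rwa [rTensor_counit_coprod]
  | cons i w ih =>
    have h : (pairing Q (i :: w)).rTensor (T k) (coprod Q y) =
        (pairing Q w).rTensor (T k) ((skewDer Q i).rTensor (T k) (coprod Q y)) := by
      rw [← LinearMap.rTensor_comp_apply]; rfl
    rw [h, rTensor_skewDer_coprod]
    exact ih (skewDer_mem_radicalSubmodule hy i)

/-- If `I` is the common kernel of functionals `f w` and `f w ⊗ id` maps `t` into `I` for all `w`,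
then `t ∈ I ⊗ M + M ⊗ I`. -/
theorem mem_span_tmul_of_forall_rTensor {M ι : Type*} [AddCommGroup M] [Module k M]
    (I : Submodule k M) (f : ι → M →ₗ[k] k) (hI : ∀ y, (∀ w, f w y = 0) → y ∈ I) (t : M ⊗[k] M)
    (ht : ∀ w, TensorProduct.lid k M ((f w).rTensor M t) ∈ I) :
    t ∈ Submodule.span k {t : M ⊗[k] M | ∃ a ∈ I, ∃ b : M, t = a ⊗ₜ b ∨ t = b ⊗ₜ a} := by
  set S := Submodule.span k {t : M ⊗[k] M | ∃ a ∈ I, ∃ b : M, t = a ⊗ₜ b ∨ t = b ⊗ₜ a}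
  let b := Module.Basis.ofVectorSpace k (M ⧸ I)
  obtain ⟨c, hc⟩ := TensorProduct.eq_repr_basis_right b (I.mkQ.lTensor M t)
  have hcomm : ∀ (g : M →ₗ[k] k) (t : M ⊗[k] M),
      TensorProduct.lid k (M ⧸ I) (g.rTensor (M ⧸ I) (I.mkQ.lTensor M t)) =
        I.mkQ (TensorProduct.lid k M (g.rTensor M t)) := by
    intro g t
    induction t with
    | zero => simp
    | tmul a b => simp
    | add a b ha hb => simp only [map_add, ha, hb]
  -- The contraction of `t` with `f w` is zero in `M ⧸ I`; independence of the basis `b` then gives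
  -- `f w (c i) = 0` for every `w`.
  have hcI : ∀ i, c i ∈ I := by
    intro i
    refine hI _ fun w => ?_
    have h1 := hcomm (f w) t
    rw [(Submodule.Quotient.mk_eq_zero I).2 (ht w) |> fun h => (h : I.mkQ _ = 0), ← hc,
      Finsupp.sum, map_sum, map_sum] at h1
    simp only [LinearMap.rTensor_tmul, TensorProduct.lid_tmul] at h1
    by_cases hi : i ∈ c.support
    · exact linearIndependent_iff'.1 b.linearIndependent c.support (fun i => f w (c i)) h1 i hi
    · rw [Finsupp.notMem_support_iff.1 hi, map_zero]
  choose β hβ using fun i => I.mkQ_surjective (b i)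
  have h1 : (c.sum fun i m => m ⊗ₜ[k] β i) ∈ S :=
    Submodule.sum_mem _ fun i _ => Submodule.subset_span ⟨c i, hcI i, β i, Or.inl rfl⟩
  -- Lifting the basis to `M` corrects `t` by an element of `I ⊗ M`; by right exactness the rest
  -- comes from `M ⊗ I`.
  have h2 : I.mkQ.lTensor M (t - c.sum fun i m => m ⊗ₜ[k] β i) = 0 := by
    rw [map_sub, ← hc, Finsupp.sum, Finsupp.sum, map_sum]
    simp [hβ]
  have h3 : ∀ t' : M ⊗[k] I, I.subtype.lTensor M t' ∈ S := by
    intro t'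
    induction t' with
    | zero => simp
    | tmul a y => exact Submodule.subset_span ⟨y, y.2, a, Or.inr (by simp)⟩
    | add a b ha hb => rw [map_add]; exact Submodule.add_mem _ ha hb
  obtain ⟨t', ht'⟩ := (lTensor_exact M (LinearMap.exact_subtype_mkQ I)
    I.mkQ_surjective _).1 h2
  rw [← sub_add_cancel t (c.sum fun i m => m ⊗ₜ[k] β i), ← ht']
  exact Submodule.add_mem _ (h3 t') h1

/-! ### The grading, and the radical as a graded coideal. -/

theorem one_mem_degPart : (1 : T k) ∈ degPart k 0 :=
  Submodule.subset_span ⟨Fin.elim0, by simp⟩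

theorem x_mul_mem_degPart (j : Fin 2) {m : ℕ} {y : T k} (hy : y ∈ degPart k m) :
    x j * y ∈ degPart k (m + 1) := by
  induction hy using Submodule.span_induction with
  | mem y hy =>
    obtain ⟨w, rfl⟩ := hy
    exact Submodule.subset_span ⟨Fin.cons j w, by simp [List.ofFn_succ]⟩
  | zero => simp
  | add y z _ _ hy hz => rw [mul_add]; exact Submodule.add_mem _ hy hz
  | smul a y _ hy => rw [mul_smul_comm]; exact Submodule.smul_mem _ a hy

theorem degPart_zero_le {S : Submodule k (T k)} (one : 1 ∈ S) : degPart k 0 ≤ S := by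
  rw [degPart, Submodule.span_le]
  rintro _ ⟨w, rfl⟩
  simpa using one

theorem degPart_succ_le {m : ℕ} {S : Submodule k (T k)}
    (x_mul : ∀ j, ∀ y ∈ degPart k m, x j * y ∈ S) : degPart k (m + 1) ≤ S := by
  rw [degPart, Submodule.span_le]
  rintro _ ⟨w, rfl⟩
  simp only [List.ofFn_succ, List.prod_cons]
  exact x_mul _ _ (Submodule.subset_span ⟨fun a => w a.succ, rfl⟩)

theorem skewDer_of_mem_degPart_zero (Q : Matrix (Fin 2) (Fin 2) k) (i : Fin 2) {y : T k}
    (hy : y ∈ degPart k 0) : skewDer Q i y = 0 :=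
  degPart_zero_le (S := LinearMap.ker (skewDer Q i)) (by simp) hy

theorem skewDer_mem_degPart (Q : Matrix (Fin 2) (Fin 2) k) (i : Fin 2) {m : ℕ} {y : T k}
    (hy : y ∈ degPart k (m + 1)) : skewDer Q i y ∈ degPart k m := by
  induction m generalizing y with
  | zero =>
    refine degPart_succ_le (S := (degPart k 0).comap (skewDer Q i)) (fun j z hz => ?_) hy
    rw [Submodule.mem_comap, skewDer_x_mul, skewDer_of_mem_degPart_zero Q i hz]
    split_ifs <;> simp [hz]
  | succ m ih =>
    refine degPart_succ_le (S := (degPart k (m + 1)).comap (skewDer Q i)) (fun j z hz => ?_) hy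
    rw [Submodule.mem_comap, skewDer_x_mul]
    refine Submodule.add_mem _ ?_ (Submodule.smul_mem _ _ (x_mul_mem_degPart j (ih hz)))
    split_ifs <;> simp [hz]

theorem pairing_eq_zero_of_mem_degPart (Q : Matrix (Fin 2) (Fin 2) k) {m : ℕ} {y : T k}
    (hy : y ∈ degPart k m) {w : List (Fin 2)} (hw : w.length ≠ m) : pairing Q w y = 0 := by
  induction w generalizing m y with
  | nil =>
    cases m with
    | zero => simp at hw
    | succ m =>
      exact degPart_succ_le (S := LinearMap.ker (pairing Q [])) (fun j z _ => by simp) hy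
  | cons i w ih =>
    rw [pairing_cons]
    cases m with
    | zero => rw [skewDer_of_mem_degPart_zero Q i hy, map_zero]
    | succ m => exact ih (skewDer_mem_degPart Q i hy) (by simpa using hw)

theorem eq_smul_one_of_mem_degPart_zero (Q : Matrix (Fin 2) (Fin 2) k) {y : T k}
    (hy : y ∈ degPart k 0) : y = pairing Q [] y • (1 : T k) :=
  degPart_zero_le (S := LinearMap.eqLocus LinearMap.id ((pairing Q []).smulRight 1))
    (by simp) hy

theorem eq_sum_of_mem_degPart_one (Q : Matrix (Fin 2) (Fin 2) k) {y : T k}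
    (hy : y ∈ degPart k 1) : y = pairing Q [0] y • x 0 + pairing Q [1] y • x 1 := by
  refine degPart_succ_le (S := LinearMap.eqLocus LinearMap.id
    ((pairing Q [0]).smulRight (x 0) + (pairing Q [1]).smulRight (x 1))) (fun j z hz => ?_) hy
  rw [eq_smul_one_of_mem_degPart_zero Q hz]
  fin_cases j <;> simp [skewDer_x]

theorem iSup_degPart : ⨆ m, degPart k m = ⊤ := by
  refine eq_top_iff.2 fun y _ => ?_
  induction y using induction_left with
  | one => exact Submodule.mem_iSup_of_mem 0 one_mem_degPart
  | add y z hy hz => exact Submodule.add_mem _ (hy trivial) (hz trivial)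
  | smul a y hy => exact Submodule.smul_mem _ a (hy trivial)
  | x_mul j y hy =>
    have h : ⨆ m, degPart k m ≤ (⨆ m, degPart k m).comap (LinearMap.mulLeft k (x j)) :=
      iSup_le fun m y hy => Submodule.mem_iSup_of_mem (m + 1) (x_mul_mem_degPart j hy)
    exact h (hy trivial)

/-- A word of length `m` sees only degree `m`, so the radical contains the homogeneous components of
its elements. Components of degree 0 and 1 are recovered from their pairings, hence vanish. -/
theorem isGradedCoideal_radical (Q : Matrix (Fin 2) (Fin 2) k) :
    IsGradedCoideal Q (radical Q) where
  homogeneous y hy := by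
    rw [mem_radical] at hy
    obtain ⟨f, hf, rfl⟩ := (Submodule.mem_iSup_iff_exists_finsupp (degPart k) y).1
      (iSup_degPart (k := k) ▸ Submodule.mem_top)
    have hrad : ∀ m, f m ∈ radicalSubmodule Q := by
      intro m
      rw [mem_radicalSubmodule]
      intro w
      by_cases hw : w.length = m
      · have h := mem_radicalSubmodule.1 hy w
        rw [Finsupp.sum, map_sum, Finset.sum_eq_single m] at h
        · exact h
        · exact fun l _ hl => pairing_eq_zero_of_mem_degPart Q (hf l) (hw ▸ hl.symm)
        · intro hm
          rw [Finsupp.notMem_support_iff.1 hm, map_zero]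
      · exact pairing_eq_zero_of_mem_degPart Q (hf m) hw
    refine Submodule.sum_mem _ fun m _ => ?_
    match m with
    | 0 =>
      rw [eq_smul_one_of_mem_degPart_zero Q (hf 0), mem_radicalSubmodule.1 (hrad 0), zero_smul]
      exact Submodule.zero_mem _
    | 1 =>
      rw [eq_sum_of_mem_degPart_one Q (hf 1), mem_radicalSubmodule.1 (hrad 1),
        mem_radicalSubmodule.1 (hrad 1), zero_smul, zero_smul, add_zero]
      exact Submodule.zero_mem _
    | m + 2 =>
      exact Submodule.subset_span ⟨mem_radical.2 (hrad _), m + 2, by omega, hf _⟩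
  coideal y hy := by
    simp only [mem_radical] at hy ⊢
    exact mem_span_tmul_of_forall_rTensor _ (pairing Q) (fun _ => mem_radicalSubmodule.2) _
      fun w => rTensor_pairing_coprod_mem w hy

theorem nicholsMap_eq_zero_of_mem_radicalSubmodule {Q : Matrix (Fin 2) (Fin 2) k} {y : T k}
    (hy : y ∈ radicalSubmodule Q) : nicholsMap Q y = 0 := by
  have h : radical Q ≤ nicholsIdeal Q := le_sSup (isGradedCoideal_radical Q)
  have h' : y ∈ nicholsIdeal Q := h (mem_radical.2 hy)
  rw [TwoSidedIdeal.mem_iff] at h'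
  rw [← map_zero (nicholsMap Q)]
  exact (RingCon.eq _).2 h'

end Radical

/-! ### Coefficient calculus with `z = q₁₂`, `v = q₂₁`, over a commutative ring so that `z` can be
an indeterminate. -/

section Coefficients

variable {R : Type*} [CommRing R]

/-- `(n)_q` in a commutative ring. -/
def qInt (q : R) (n : ℕ) : R := ∑ i ∈ Finset.range n, q ^ i

theorem qInt_zero (q : R) : qInt q 0 = 0 := by simp [qInt]

theorem qInt_succ (q : R) (n : ℕ) : qInt q (n + 1) = qInt q n + q ^ n :=
  Finset.sum_range_succ _ _

theorem qInt_succ' (q : R) (n : ℕ) : qInt q (n + 1) = 1 + q * qInt q n := by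
  rw [qInt, qInt, Finset.sum_range_succ', Finset.mul_sum]
  simp [pow_succ', add_comm]

theorem sub_one_mul_qInt (q : R) (n : ℕ) : (q - 1) * qInt q n = q ^ n - 1 :=
  mul_geom_sum q n

/-- The coefficients of `(ad x₁)(∑ₘ c m û_m û_{l-m})` with respect to the `û_m û_{l+1-m}`. -/
def adCoeffStep (q z v : R) (l : ℕ) (c : ℕ → R) (m : ℕ) : R :=
  qInt q m * (1 - q ^ (m - 1) * (z * v)) * c (m - 1) +
    q ^ m * z * (qInt q (l + 1 - m) * (1 - q ^ (l - m) * (z * v))) * c m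

/-- The coefficients of `(ad x₁)^t(P_j)` with respect to the `û_m û_{j+t-m}`. -/
def adCoeff (q z v : R) (j : ℕ) : ℕ → ℕ → R
  | 0, m => if m ≤ j then (-v) ^ m * q ^ (m * (m - 1) / 2) else 0
  | t + 1, m => adCoeffStep q z v (j + t) (adCoeff q z v j t) m

/-- The coefficients of `d₁(∑ₘ c m û_m û_{l-m})` with respect to the `û_m û_{l-1-m}`. -/
def derCoeff (q v : R) (c : ℕ → R) (m : ℕ) : R := c (m + 1) + q ^ m * v * c m

theorem adCoeff_of_lt (q z v : R) (j t m : ℕ) (h : j + t < m) : adCoeff q z v j t m = 0 := by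
  induction t generalizing m with
  | zero => simp [adCoeff]; omega
  | succ t ih =>
    rw [adCoeff, adCoeffStep, ih (m - 1) (by omega), ih m (by omega)]
    simp

theorem succ_mul_self_half (m : ℕ) : (m + 1) * (m + 1 - 1) / 2 = m * (m - 1) / 2 + m := by
  rw [← Nat.choose_two_right, ← Nat.choose_two_right, Nat.choose_succ_succ' m 1]
  simp [add_comm]

/-- The coefficient form of `d₁(P_j) = 0`. -/
theorem derCoeff_adCoeff_zero (q z v : R) (j m : ℕ) (h : m < j) :
    derCoeff q v (adCoeff q z v j 0) m = 0 := by
  rw [derCoeff, adCoeff, adCoeff, if_pos (Nat.succ_le_of_lt h), if_pos h.le, succ_mul_self_half]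
  ring

/-- This is `d₁ (ad x₁) = q (ad x₁) d₁ + (1 - q^{2l} r²)` in degree `l α₁ + 2 α₂`, with `l = m + d`.
The truncated `m - 1` and `d - 1` are harmless: their factors `qInt q 0` vanish. -/
theorem derCoeff_adCoeffStep (q z v : R) (m d : ℕ) (c : ℕ → R) :
    derCoeff q v (adCoeffStep q z v (m + d) c) m =
      (1 - q ^ (2 * (m + d)) * (z * v) ^ 2) * c m +
        q * (qInt q m * (1 - q ^ (m - 1) * (z * v)) * derCoeff q v c (m - 1) +
          q ^ m * z * (qInt q d * (1 - q ^ (d - 1) * (z * v))) * derCoeff q v c m) := by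
  have h1 : m + d + 1 - m = d + 1 := by omega
  have h2 : m + d - m = d := by omega
  have h3 : m + d + 1 - (m + 1) = d := by omega
  have h4 : m + d - (m + 1) = d - 1 := by omega
  simp only [derCoeff, adCoeffStep, h1, h2, h3, h4, Nat.add_sub_cancel]
  rw [qInt_succ q m, qInt_succ q d]
  have hM := sub_one_mul_qInt q m
  have hD := sub_one_mul_qInt q d
  rcases m with _ | m <;> rcases d with _ | d
  all_goals
    simp only [qInt_zero, Nat.add_sub_cancel, Nat.zero_sub, zero_add, pow_zero] at hM hD ⊢
    generalize qInt q _ = M at *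
  · ring
  · linear_combination (-(z * v) * c 0) * hD
  · linear_combination (-c (m + 1)) * hM
  · generalize qInt q _ = D at *
    linear_combination (-c (m + 1)) * hM - (q ^ (2 * (m + 1)) * (z * v) * c (m + 1)) * hD

/-- As in `sl₂`-theory: `P_j` is a vector killed by `d₁`, and the commutation relation is iterated
along its `ad x₁`-string. -/
theorem derCoeff_adCoeff_succ (q z v : R) (j t m : ℕ) (h : m ≤ j + t) :
    derCoeff q v (adCoeff q z v j (t + 1)) m =
      qInt q (t + 1) * (1 - q ^ (2 * j + t) * (z * v) ^ 2) * adCoeff q z v j t m := by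
  have key : ∀ t m, m ≤ j + t → derCoeff q v (adCoeff q z v j (t + 1)) m =
      (1 - q ^ (2 * (j + t)) * (z * v) ^ 2) * adCoeff q z v j t m +
        q * (qInt q m * (1 - q ^ (m - 1) * (z * v)) *
            derCoeff q v (adCoeff q z v j t) (m - 1) +
          q ^ m * z * (qInt q (j + t - m) * (1 - q ^ (j + t - m - 1) * (z * v))) *
            derCoeff q v (adCoeff q z v j t) m) := by
    intro t m h
    obtain ⟨d, hd⟩ := Nat.exists_eq_add_of_le h
    have h2 : m + d - m = d := by omega
    have e : adCoeff q z v j (t + 1) = adCoeffStep q z v (m + d) (adCoeff q z v j t) := by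
      funext l
      rw [adCoeff, hd]
    rw [e, derCoeff_adCoeffStep, hd, h2]
  induction t generalizing m with
  | zero =>
    rw [key 0 m h]
    have h1 : qInt q m * derCoeff q v (adCoeff q z v j 0) (m - 1) = 0 := by
      rcases m with _ | m
      · rw [qInt_zero, zero_mul]
      · rw [Nat.add_sub_cancel, derCoeff_adCoeff_zero q z v j m (by omega), mul_zero]
    have h2 : qInt q (j + 0 - m) * derCoeff q v (adCoeff q z v j 0) m = 0 := by
      rcases (show m ≤ j from h).eq_or_lt with rfl | hm
      · simp [qInt_zero]
      · rw [derCoeff_adCoeff_zero q z v j m hm, mul_zero]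
    rw [qInt_succ, qInt_zero]
    linear_combination (q * (1 - q ^ (m - 1) * (z * v))) * h1 +
      (q * q ^ m * z * (1 - q ^ (j + 0 - m - 1) * (z * v))) * h2
  | succ t ih =>
    rw [key (t + 1) m h]
    set E := qInt q (t + 1) * (1 - q ^ (2 * j + t) * (z * v) ^ 2)
    -- The induction hypothesis fails to cover the ends `m = 0` here and `m = j + t + 1` in `h2`,
    -- but there the quantum number in front is zero.
    have h1 : qInt q m * derCoeff q v (adCoeff q z v j (t + 1)) (m - 1) =
        qInt q m * (E * adCoeff q z v j t (m - 1)) := by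
      rcases m with _ | m
      · rw [qInt_zero, zero_mul, zero_mul]
      · rw [Nat.add_sub_cancel, ih m (by omega)]
    have h2 : qInt q (j + (t + 1) - m) * derCoeff q v (adCoeff q z v j (t + 1)) m =
        qInt q (j + (t + 1) - m) * (E * adCoeff q z v j t m) := by
      rcases h.eq_or_lt with rfl | hm
      · simp [qInt_zero]
      · rw [ih m (by omega)]
    have h3 : adCoeff q z v j (t + 1) m = qInt q m * (1 - q ^ (m - 1) * (z * v)) *
          adCoeff q z v j t (m - 1) +
        q ^ m * z * (qInt q (j + (t + 1) - m) * (1 - q ^ (j + (t + 1) - m - 1) * (z * v))) *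
          adCoeff q z v j t m := by
      rw [adCoeff, adCoeffStep, show j + (t + 1) - m = j + t + 1 - m by omega,
        show j + t + 1 - m - 1 = j + t - m by omega]
    have h4 : 1 - q ^ (2 * (j + (t + 1))) * (z * v) ^ 2 + q * E =
        qInt q (t + 1 + 1) * (1 - q ^ (2 * j + (t + 1)) * (z * v) ^ 2) := by
      have h5 := qInt_succ q (t + 1)
      have h6 := qInt_succ' q (t + 1)
      have h7 := sub_one_mul_qInt q (t + 1)
      simp only [E]
      rw [h5]
      generalize qInt q (t + 1) = M at *
      linear_combination h7
    rw [← h4]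
    linear_combination (q * (1 - q ^ (m - 1) * (z * v))) * h1 +
      (q * q ^ m * z * (1 - q ^ (j + (t + 1) - m - 1) * (z * v))) * h2 - q * E * h3

/-- A telescoping sum. -/
theorem sum_mul_derCoeff (q v : R) (e c : ℕ → R) (he : ∀ m, e m = -(q ^ (m + 1) * v) * e (m + 1))
    (n : ℕ) : ∑ m ∈ Finset.range n, e m * derCoeff q v c m = v * e 0 * c 0 - q ^ n * v * e n * c n := by
  induction n with
  | zero => simp
  | succ n ih =>
    rw [Finset.sum_range_succ, ih, derCoeff, mul_add, he n]
    ring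

theorem adCoeff_first (q z v : R) (j t : ℕ) : adCoeff q z v j t 0 =
    z ^ t * ∏ i ∈ Finset.range t, (qInt q (j + i + 1) * (1 - q ^ (j + i) * (z * v))) := by
  induction t with
  | zero => simp [adCoeff]
  | succ t ih =>
    rw [adCoeff, adCoeffStep, ih, qInt_zero, Finset.prod_range_succ, Nat.sub_zero, Nat.sub_zero]
    ring

theorem adCoeff_last (q z v : R) (j t : ℕ) : adCoeff q z v j t (j + t) =
    (-v) ^ j * q ^ (j * (j - 1) / 2) *
      ∏ i ∈ Finset.range t, (qInt q (j + i + 1) * (1 - q ^ (j + i) * (z * v))) := by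
  induction t with
  | zero => simp [adCoeff]
  | succ t ih =>
    rw [adCoeff, adCoeffStep, adCoeff_of_lt q z v j t (j + (t + 1)) (by omega),
      Finset.prod_range_succ, show j + (t + 1) - 1 = j + t by omega, ih, ← add_assoc]
    ring

theorem map_adCoeff {S : Type*} [CommRing S] (f : R →+* S) (q z v : R) (j t m : ℕ) :
    f (adCoeff q z v j t m) = adCoeff (f q) (f z) (f v) j t m := by
  induction t generalizing m with
  | zero => simp only [adCoeff]; split_ifs <;> simp
  | succ t ih => simp [adCoeff, adCoeffStep, ih, qInt]

/-- Doubling makes the divisions exact; half of the last summand is the exponent of `q` that remains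
in `sum_mul_adCoeff`. -/
theorem choose_half (j N : ℕ) :
    (j + N) * (j + N - 1) / 2 * 2 = j * (j - 1) / 2 * 2 + N * (2 * j + N - 1) := by
  have h : ∀ m, m * (m - 1) / 2 * 2 = m * (m - 1) := fun m =>
    Nat.div_mul_cancel (Nat.even_mul_pred_self m).two_dvd
  rw [h, h]
  rcases j with _ | j <;> rcases N with _ | N <;> simp
  ring

/-- The alternating sum of the coefficients of `(ad x₁)^t(P_j)`, up to the scalar factor that may
vanish. -/
theorem sum_mul_adCoeff (q z v : R) (e : ℕ → R) (he : ∀ m, e m = -(q ^ (m + 1) * v) * e (m + 1))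
    (j t : ℕ) :
    qInt q (t + 1) * (1 - q ^ (2 * j + t) * (z * v) ^ 2) *
        ∑ m ∈ Finset.range (j + t + 1), e m * adCoeff q z v j t m =
      q ^ (j + t + 1) * v * e (j + t + 1) * (-v) ^ j * q ^ (j * (j - 1) / 2) *
        (∏ i ∈ Finset.range (t + 1), (qInt q (j + i + 1) * (1 - q ^ (j + i) * (z * v)))) *
        ((-(z * v)) ^ (t + 1) *
          q ^ ((j + (t + 1)) * (j + (t + 1) - 1) / 2 - j * (j - 1) / 2) - 1) := by
  -- Expresses both boundary terms of the telescoping sum through the same value of `e`;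
  -- `adCoeff_first` and `adCoeff_last` share their product, so it factors out.
  have he0 : ∀ n, e 0 = (-v) ^ n * q ^ (n * (n - 1) / 2 + n) * e n := by
    intro n
    induction n with
    | zero => simp
    | succ n ih => rw [ih, he n, succ_mul_self_half]; ring
  have h := sum_mul_derCoeff q v e (adCoeff q z v j (t + 1)) he (j + t + 1)
  rw [Finset.sum_congr rfl fun m hm => by
    rw [derCoeff_adCoeff_succ q z v j t m (by simp at hm; omega)]] at h
  rw [Finset.mul_sum]
  rw [add_assoc j t 1] at h ⊢
  rw [adCoeff_last, adCoeff_first, he0 (j + (t + 1))] at h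
  have hle : j * (j - 1) / 2 ≤ (j + (t + 1)) * (j + (t + 1) - 1) / 2 := by
    have := choose_half j (t + 1)
    omega
  obtain ⟨E, hE⟩ := Nat.exists_eq_add_of_le hle
  rw [hE] at h
  rw [hE, Nat.add_sub_cancel_left]
  calc _ = _ := Finset.sum_congr rfl fun m _ => by ring
    _ = _ := h
    _ = _ := by
      rw [neg_pow (z * v), mul_pow, neg_pow v (j + (t + 1)), neg_pow v j]
      ring

end Coefficients

/-! ### Vanishing of the weighted sum, by making `q₁₂` generic. -/

section Vanishing

variable {k : Type*} [Field k]

theorem qNum_eq_qInt (q : k) (n : ℕ) : qNum q n = qInt q n := rfl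

/-- The alternating sum of the coefficients of `(ad x₁)^(n-j-1)(P_j)` vanishes. -/
theorem sum_mul_adCoeff_eq_zero (q z v : k) (e : ℕ → k)
    (he : ∀ m, e m = -(q ^ (m + 1) * v) * e (m + 1)) (j t : ℕ) (ht : qInt q (t + 1) ≠ 0)
    (heven : Even (t + 1) → qInt (q ^ (2 * j + t) * (z * v) ^ 2) ((t + 1) / 2) = 0)
    (hodd : Odd (t + 1) → qInt (-(q ^ ((2 * j + t) / 2) * (z * v))) (t + 1) = 0 ∧
      1 - q ^ ((2 * j + t) / 2) * (z * v) ≠ 0) :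
    ∑ m ∈ Finset.range (j + t + 1), e m * adCoeff q z v j t m = 0 := by
  -- Over `k[X]` the factor `1 - q^{2j+t} r²` is nonzero and can be cancelled before evaluating at
  -- `z`.
  have hC := sum_mul_adCoeff (Polynomial.C q) Polynomial.X (Polynomial.C v)
    (fun m => Polynomial.C (e m)) (fun m => by rw [he m]; simp) j t
  have hE := choose_half j (t + 1)
  have hle : j * (j - 1) / 2 ≤ (j + (t + 1)) * (j + (t + 1) - 1) / 2 := by omega
  obtain ⟨E, hE'⟩ := Nat.exists_eq_add_of_le hle
  rw [hE', Nat.add_sub_cancel_left] at hC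
  have hE2 : E * 2 = (t + 1) * (2 * j + t) := by
    rw [show 2 * j + (t + 1) - 1 = 2 * j + t by omega] at hE
    omega
  clear hE hle hE'
  set S : Polynomial k := ∑ m ∈ Finset.range (j + t + 1),
    Polynomial.C (e m) * adCoeff (Polynomial.C q) Polynomial.X (Polynomial.C v) j t m with hS
  have hSeval : S.eval z = ∑ m ∈ Finset.range (j + t + 1), e m * adCoeff q z v j t m := by
    rw [hS, Polynomial.eval_finsetSum]
    refine Finset.sum_congr rfl fun m _ => ?_
    rw [Polynomial.eval_mul, Polynomial.eval_C, ← Polynomial.coe_evalRingHom, map_adCoeff]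
    simp
  rw [← hSeval]
  have hqmap : ∀ n, (qInt (Polynomial.C q) n : Polynomial k) = Polynomial.C (qInt q n) := by
    simp [qInt]
  have hqeval : ∀ (a : Polynomial k) n, (qInt a n).eval z = qInt (a.eval z) n := by
    simp [qInt, Polynomial.eval_finsetSum]
  set r : Polynomial k := Polynomial.X * Polynomial.C v with hr
  have hr0 : r.eval 0 = 0 := by simp [hr]
  have hrz : r.eval z = z * v := by
    rw [hr, Polynomial.eval_mul, Polynomial.eval_X, Polynomial.eval_C]
  obtain ⟨K, hK⟩ : ∃ K, qInt (Polynomial.C q) (t + 1) *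
      (1 - Polynomial.C q ^ (2 * j + t) * r ^ 2) * S =
        K * ((-r) ^ (t + 1) * Polynomial.C q ^ E - 1) := ⟨_, hC⟩
  rw [hqmap] at hK
  clear hC
  rcases Nat.even_or_odd (t + 1) with hN | hN
  · obtain ⟨M, hM⟩ := hN
    have hEM : E = (2 * j + t) * M := by
      have : E * 2 = (2 * j + t) * M * 2 := by rw [hE2, hM]; ring
      omega
    have h0 := heven ⟨M, hM⟩
    rw [show (t + 1) / 2 = M by omega] at h0
    set X := Polynomial.C q ^ (2 * j + t) * r ^ 2 with hX
    -- For `t + 1 = 2M` the left side is `X^M - 1`, a geometric sum with the factor to be cancelled.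
    have h1 : (-r) ^ (t + 1) * Polynomial.C q ^ E - 1 = (X - 1) * qInt X M := by
      rw [sub_one_mul_qInt, mul_pow, ← pow_mul, ← pow_mul, Even.neg_pow ⟨M, hM⟩, ← hEM,
        show t + 1 = 2 * M by omega, mul_comm]
    have hne : X - 1 ≠ 0 := by
      intro h
      simpa [hX, hr0] using congrArg (Polynomial.eval 0) h
    have h2 : -(Polynomial.C (qInt q (t + 1)) * S) = K * qInt X M :=
      mul_left_cancel₀ hne (by rw [h1] at hK; linear_combination hK)
    have h3 := congrArg (Polynomial.eval z) h2
    have hXz : X.eval z = q ^ (2 * j + t) * (z * v) ^ 2 := by simp [hX, hrz]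
    rw [Polynomial.eval_mul, hqeval, hXz, h0, mul_zero, Polynomial.eval_neg, neg_eq_zero,
      Polynomial.eval_mul, Polynomial.eval_C] at h3
    exact (mul_eq_zero.1 h3).resolve_left ht
  · obtain ⟨h0, h0'⟩ := hodd hN
    obtain ⟨M, hM⟩ := hN
    have hd : (2 * j + t) / 2 * 2 = 2 * j + t := by omega
    have hEM : E = (2 * j + t) / 2 * (t + 1) := by
      have : E * 2 = (2 * j + t) / 2 * (t + 1) * 2 := by
        rw [hE2, mul_right_comm, hd, mul_comm]
      omega
    rw [← hd, pow_mul, ← mul_pow] at hK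
    set Y := Polynomial.C q ^ ((2 * j + t) / 2) * r with hY
    -- For odd `t + 1` the scalar is `1 - Y² = (1 - Y)(1 + Y)`. Only `1 + Y` is cancelled; `1 - Y`
    -- is nonzero at `z` by `h0'`.
    have h1 : (-r) ^ (t + 1) * Polynomial.C q ^ E - 1 = (-Y - 1) * qInt (-Y) (t + 1) := by
      rw [sub_one_mul_qInt, hY, neg_pow (_ * r), mul_pow, ← pow_mul, ← hEM, neg_pow r]
      ring
    have hne : -Y - 1 ≠ 0 := by
      intro h
      simpa [hY, hr0] using congrArg (Polynomial.eval 0) h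
    have h2 : -((1 - Y) * (Polynomial.C (qInt q (t + 1)) * S)) = K * qInt (-Y) (t + 1) :=
      mul_left_cancel₀ hne (by rw [h1] at hK; linear_combination hK)
    have h3 := congrArg (Polynomial.eval z) h2
    have hYz : Y.eval z = q ^ ((2 * j + t) / 2) * (z * v) := by simp [hY, hrz]
    simp only [Polynomial.eval_mul, Polynomial.eval_neg, Polynomial.eval_sub, Polynomial.eval_one,
      Polynomial.eval_C, hqeval, hYz, h0, mul_zero, neg_eq_zero] at h3
    exact (mul_eq_zero.1 ((mul_eq_zero.1 h3).resolve_left h0')).resolve_left ht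

end Vanishing

/-! ### Linear independence of the products `u_m u_{n-m}`. -/

section Independence

variable {k : Type*} [Field k] (Q : Matrix (Fin 2) (Fin 2) k)

/-- A representation of `T(V)` on `k[X]³` in which `x₁` is diagonal and `x₂` shifts the basis. -/
def shiftRep (k : Type*) [Field k] : T k →ₐ[k] Matrix (Fin 3) (Fin 3) (Polynomial k) :=
  FreeAlgebra.lift k ![!![0, 0, 0; 0, 1, 0; 0, 0, Polynomial.X], !![0, 0, 0; 1, 0, 0; 0, 1, 0]]

/-- `∏_{s < n} (X - q^s q₁₂)`. -/
def shiftPoly (n : ℕ) : Polynomial k :=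
  ∏ s ∈ Finset.range n, (Polynomial.X - Polynomial.C (Q 0 0 ^ s * Q 0 1))

theorem shiftRep_u (n : ℕ) :
    shiftRep k (u Q n) = !![0, 0, 0; 1, 0, 0; 0, shiftPoly Q n, 0] := by
  induction n with
  | zero => simp [u, shiftRep, shiftPoly]
  | succ n ih =>
    rw [u, map_sub, map_smul, map_mul, map_mul, ih]
    have h : shiftRep k (x 0) = !![0, 0, 0; 0, 1, 0; 0, 0, Polynomial.X] := by simp [shiftRep]
    have h' : shiftPoly Q (n + 1) =
        shiftPoly Q n * (Polynomial.X - Polynomial.C (Q 0 0 ^ n * Q 0 1)) :=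
      Finset.prod_range_succ _ _
    rw [h, h', ← algebraMap_smul (Polynomial k)]
    ext i j : 1
    fin_cases i <;> fin_cases j <;> simp
    ring

theorem linearIndependent_shiftPoly : LinearIndependent k (shiftPoly Q) := by
  have h : ∀ n, (shiftPoly Q n).degree = n := fun n => by
    rw [shiftPoly, Polynomial.degree_prod,
      Finset.sum_congr rfl fun _ _ => Polynomial.degree_X_sub_C _]
    simp
  exact (Polynomial.Sequence.mk (shiftPoly Q) h).linearIndependent

/-- The lower left corner of `shiftRep` sends `u_m u_{n-m}` to `shiftPoly Q m`, of degree `m`;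
distinct degrees give independence. -/
theorem eq_zero_of_sum_u_mul_u_eq_zero (n : ℕ) (c : ℕ → k)
    (h : ∑ m ∈ Finset.range (n + 1), c m • (u Q m * u Q (n - m)) = 0) (m : ℕ) (hm : m ≤ n) :
    c m = 0 := by
  refine linearIndependent_iff'.1 (linearIndependent_shiftPoly Q) (Finset.range (n + 1)) c ?_ m
    (by simpa [Nat.lt_succ_iff] using hm)
  have h1 := congrArg (fun y => shiftRep k y 2 0) h
  simpa [map_sum, Matrix.sum_apply, shiftRep_u] using h1

end Independence

/-! ### The elements `û_n` and their quadratic combinations in `T(V)`. -/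

section Elements

variable {k : Type*} [Field k] (Q : Matrix (Fin 2) (Fin 2) k)

theorem scale_u (c : Fin 2 → k) (n : ℕ) : scale c (u Q n) = (c 0 ^ n * c 1) • u Q n := by
  induction n with
  | zero => simp [u]
  | succ n ih =>
    rw [u, map_sub, map_smul, map_mul, map_mul, ih, scale_x, smul_sub]
    simp only [smul_mul_smul_comm, smul_smul]
    ring_nf

theorem scale_uHat (c : Fin 2 → k) (n : ℕ) :
    scale c (uHat Q n) = (c 0 ^ n * c 1) • uHat Q n := by
  rw [uHat, map_smul, scale_u, smul_comm]

theorem adx_mul (i : Fin 2) (y z : T k) :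
    adx Q i (y * z) = adx Q i y * z + scale (Q i) y * adx Q i z := by
  simp only [adx, twistL_eq_scale, LinearMap.sub_apply, LinearMap.mulLeft_apply,
    LinearMap.comp_apply, LinearMap.mulRight_apply, AlgHom.toLinearMap_apply, map_mul]
  noncomm_ring

theorem adx_u (n : ℕ) : adx Q 0 (u Q n) = u Q (n + 1) := by
  simp [adx, twistL_eq_scale, scale_u, u]

theorem skewDer_zero_u (n : ℕ) : skewDer Q 0 (u Q (n + 1)) =
    (qNum (Q 0 0) (n + 1) * (1 - Q 0 0 ^ n * (Q 0 1 * Q 1 0))) • u Q n := by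
  induction n with
  | zero =>
    simp only [u, map_sub, map_smul, skewDer_mul, skewDer_x, twistR_eq_scale, scale_x, qNum]
    simp [sub_smul, smul_smul]
  | succ n ih =>
    have h := qInt_succ (Q 0 0) (n + 1)
    have h' := sub_one_mul_qInt (Q 0 0) (n + 1)
    rw [← qNum_eq_qInt, ← qNum_eq_qInt] at h
    rw [← qNum_eq_qInt] at h'
    rw [u, map_sub, map_smul, skewDer_mul, skewDer_mul, ih, skewDer_x, twistR_eq_scale, scale_x,
      scale_u, h]
    generalize qNum (Q 0 0) (n + 1) = M at *
    simp only [if_pos, one_mul, mul_one, smul_mul_assoc, mul_smul_comm]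
    have e : x 0 * u Q n = u Q (n + 1) + (Q 0 0 ^ n * Q 0 1) • (u Q n * x 0) := by simp [u]
    rw [e]
    match_scalars
    · linear_combination h'
    · ring

theorem skewDer_one_u (n : ℕ) : skewDer Q 1 (u Q (n + 1)) = 0 := by
  induction n with
  | zero =>
    simp [u, skewDer_mul, skewDer_x, twistR_eq_scale, scale_x]
  | succ n ih =>
    rw [u, map_sub, map_smul, skewDer_mul, skewDer_mul, ih]
    simp [skewDer_x]

theorem skewDer_one_u_zero : skewDer Q 1 (u Q 0) = 1 := by
  simp [u, skewDer_x]

/-- The denominator of `û_n`. -/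
def uDenom (n : ℕ) : k := qFact (Q 0 0) n * bProd (Q 0 0) (Q 0 1 * Q 1 0) n

theorem uDenom_succ (n : ℕ) : uDenom Q (n + 1) =
    uDenom Q n * (qNum (Q 0 0) (n + 1) * (1 - Q 0 0 ^ n * (Q 0 1 * Q 1 0))) := by
  simp only [uDenom, qFact, bProd, Finset.prod_range_succ]
  ring

variable {Q}

theorem uDenom_ne_zero_of_le {m n : ℕ} (h : m ≤ n) (hn : uDenom Q n ≠ 0) : uDenom Q m ≠ 0 := by
  induction h with
  | refl => exact hn
  | step _ ih => exact ih (left_ne_zero_of_mul (uDenom_succ Q _ ▸ hn))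

theorem uHat_eq (n : ℕ) : uHat Q n = (uDenom Q n)⁻¹ • u Q n := rfl

theorem skewDer_zero_uHat_zero : skewDer Q 0 (uHat Q 0) = 0 := by
  simp [uHat_eq, u, skewDer_x]

theorem skewDer_zero_uHat_succ {n : ℕ} (hn : uDenom Q (n + 1) ≠ 0) :
    skewDer Q 0 (uHat Q (n + 1)) = uHat Q n := by
  have h := uDenom_succ Q n
  rw [uHat_eq, uHat_eq, map_smul, skewDer_zero_u, smul_smul, h, mul_inv, mul_assoc,
    inv_mul_cancel₀ (right_ne_zero_of_mul (h ▸ hn)), mul_one]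

theorem skewDer_one_uHat_zero : skewDer Q 1 (uHat Q 0) = 1 := by
  simp [uHat_eq, skewDer_one_u_zero, uDenom, qFact, bProd]

theorem skewDer_one_uHat_succ (n : ℕ) : skewDer Q 1 (uHat Q (n + 1)) = 0 := by
  rw [uHat_eq, map_smul, skewDer_one_u, smul_zero]

theorem adx_uHat {n : ℕ} (hn : uDenom Q (n + 1) ≠ 0) : adx Q 0 (uHat Q n) =
    (qInt (Q 0 0) (n + 1) * (1 - Q 0 0 ^ n * (Q 0 1 * Q 1 0))) • uHat Q (n + 1) := by
  have h := uDenom_succ Q n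
  rw [qNum_eq_qInt] at h
  rw [uHat_eq, uHat_eq, map_smul, adx_u, smul_smul, h, mul_inv_rev, ← mul_assoc,
    mul_inv_cancel₀ (right_ne_zero_of_mul (h ▸ hn)), one_mul]

variable (Q) in
/-- `∑ₘ c m û_m û_{l-m}`. -/
def quad (l : ℕ) (c : ℕ → k) : T k :=
  ∑ m ∈ Finset.range (l + 1), c m • (uHat Q m * uHat Q (l - m))

/-- Any `z` is allowed, since the coefficients at `t = 0` do not involve it. -/
theorem P_eq_quad (z : k) (j : ℕ) : P Q j = quad Q j (adCoeff (Q 0 0) z (Q 1 0) j 0) := by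
  rw [P, quad]
  refine Finset.sum_congr rfl fun m hm => ?_
  rw [adCoeff, if_pos (by simpa [Nat.lt_succ_iff] using hm)]

theorem adx_quad {l : ℕ} (hl : uDenom Q (l + 1) ≠ 0) (c : ℕ → k) (hc : c (l + 1) = 0) :
    adx Q 0 (quad Q l c) = quad Q (l + 1) (adCoeffStep (Q 0 0) (Q 0 1) (Q 1 0) l c) := by
  have h : ∀ m ∈ Finset.range (l + 1), adx Q 0 (c m • (uHat Q m * uHat Q (l - m))) =
      (qInt (Q 0 0) (m + 1) * (1 - Q 0 0 ^ m * (Q 0 1 * Q 1 0)) * c m) •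
          (uHat Q (m + 1) * uHat Q (l + 1 - (m + 1))) +
        (Q 0 0 ^ m * Q 0 1 * (qInt (Q 0 0) (l + 1 - m) *
          (1 - Q 0 0 ^ (l - m) * (Q 0 1 * Q 1 0))) * c m) •
          (uHat Q m * uHat Q (l + 1 - m)) := by
    intro m hm
    have hm' : m ≤ l := by simpa [Nat.lt_succ_iff] using hm
    have e : l + 1 - m = l - m + 1 := by omega
    rw [map_smul, adx_mul, adx_uHat (uDenom_ne_zero_of_le (by omega) hl),
      adx_uHat (uDenom_ne_zero_of_le (by omega) hl), scale_uHat, e, Nat.add_sub_add_right]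
    simp only [smul_mul_assoc, mul_smul_comm, smul_add, smul_smul]
    congr 2 <;> ring
  rw [quad, map_sum, Finset.sum_congr rfl h, Finset.sum_add_distrib, quad]
  simp only [adCoeffStep, add_smul, Finset.sum_add_distrib]
  congr 1
  · rw [Finset.sum_range_succ' _ (l + 1)]
    simp [qInt_zero]
  · rw [Finset.sum_range_succ _ (l + 1)]
    simp [hc]

theorem adx_pow_P {j t : ℕ} (h : uDenom Q (j + t) ≠ 0) : (adx Q 0 ^ t) (P Q j) =
    quad Q (j + t) (adCoeff (Q 0 0) (Q 0 1) (Q 1 0) j t) := by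
  induction t with
  | zero => exact P_eq_quad _ _
  | succ t ih =>
    rw [pow_succ', Module.End.mul_apply, ih (uDenom_ne_zero_of_le (by omega) h)]
    exact adx_quad h _ (adCoeff_of_lt _ _ _ _ _ _ (Nat.lt_succ_self _))

theorem skewDer_zero_quad {l : ℕ} (hl : uDenom Q (l + 1) ≠ 0) (c : ℕ → k) :
    skewDer Q 0 (quad Q (l + 1) c) = quad Q l (derCoeff (Q 0 0) (Q 1 0) c) := by
  have h : ∀ m ≤ l + 1, skewDer Q 0 (c m • (uHat Q m * uHat Q (l + 1 - m))) =
      c m • (skewDer Q 0 (uHat Q m) * uHat Q (l + 1 - m)) +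
        (Q 0 0 ^ m * Q 1 0 * c m) • (uHat Q m * skewDer Q 0 (uHat Q (l + 1 - m))) := by
    intro m hm
    rw [map_smul, skewDer_mul, twistR_eq_scale, scale_uHat, smul_add, smul_mul_assoc, smul_smul,
      mul_comm (c m)]
  rw [quad, map_sum, Finset.sum_congr rfl fun m hm =>
    h m (by simpa [Nat.lt_succ_iff] using hm), Finset.sum_add_distrib,
    Finset.sum_range_succ', Finset.sum_range_succ _ (l + 1), quad]
  simp only [derCoeff, add_smul, Finset.sum_add_distrib]
  simp only [skewDer_zero_uHat_zero, zero_mul, smul_zero, add_zero, Nat.sub_self, mul_zero]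
  congr 1
  · refine Finset.sum_congr rfl fun m hm => ?_
    have hm' : m < l + 1 := by simpa using hm
    rw [skewDer_zero_uHat_succ (uDenom_ne_zero_of_le (by omega) hl), Nat.add_sub_add_right]
  · refine Finset.sum_congr rfl fun m hm => ?_
    have hm' : m < l + 1 := by simpa using hm
    rw [show l + 1 - m = l - m + 1 by omega,
      skewDer_zero_uHat_succ (uDenom_ne_zero_of_le (by omega) hl)]

/-- `d₂` kills `û_m` for `m > 0`, so only the end terms, which contain `û_0`, contribute. -/
theorem skewDer_one_quad (l : ℕ) (c : ℕ → k) : skewDer Q 1 (quad Q l c) =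
    (c 0 + Q 0 1 ^ l * Q 1 1 * c l) • uHat Q l := by
  have h : ∀ m, skewDer Q 1 (c m • (uHat Q m * uHat Q (l - m))) =
      c m • (skewDer Q 1 (uHat Q m) * uHat Q (l - m)) +
        (Q 0 1 ^ m * Q 1 1 * c m) • (uHat Q m * skewDer Q 1 (uHat Q (l - m))) := by
    intro m
    rw [map_smul, skewDer_mul, twistR_eq_scale, scale_uHat, smul_add, smul_mul_assoc, smul_smul,
      mul_comm (c m)]
  rw [quad, map_sum, Finset.sum_congr rfl fun m _ => h m, Finset.sum_add_distrib, add_smul]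
  congr 1
  · rw [Finset.sum_range_succ']
    simp [skewDer_one_uHat_succ, skewDer_one_uHat_zero]
  · rw [Finset.sum_range_succ, Finset.sum_eq_zero]
    · simp [skewDer_one_uHat_zero]
    · intro m hm
      have hm' : m < l := by simpa using hm
      rw [show l - m = l - m - 1 + 1 by omega, skewDer_one_uHat_succ]
      simp

theorem pairing_nil_u (n : ℕ) : pairing Q [] (u Q n) = 0 := by
  induction n with
  | zero => simp [u]
  | succ n ih => simp [u]

theorem pairing_nil_quad (l : ℕ) (c : ℕ → k) : pairing Q [] (quad Q l c) = 0 := by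
  simp [quad, uHat_eq, pairing_nil_u]

theorem quad_eq_zero {l : ℕ} (hl : uDenom Q l ≠ 0) {c : ℕ → k} (h : quad Q l c = 0) {m : ℕ}
    (hm : m ≤ l) : c m = 0 := by
  have h1 := eq_zero_of_sum_u_mul_u_eq_zero Q l
    (fun m => c m * ((uDenom Q m)⁻¹ * (uDenom Q (l - m))⁻¹)) ?_ m hm
  · simpa [uDenom_ne_zero_of_le hm hl, uDenom_ne_zero_of_le (Nat.sub_le l m) hl] using h1
  · rw [← h, quad]
    refine Finset.sum_congr rfl fun m _ => ?_
    rw [uHat_eq, uHat_eq, smul_mul_smul_comm, smul_smul]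

theorem mem_U'_iff {n : ℕ} (hn : uDenom Q n ≠ 0) {y : T k} :
    y ∈ U' Q n ↔ ∃ c : ℕ → k, c n = 0 ∧ y = quad Q n c := by
  constructor
  · intro hy
    induction hy using Submodule.span_induction with
    | mem y hy =>
      obtain ⟨i, hi, rfl⟩ := hy
      refine ⟨Pi.single i (uDenom Q i * uDenom Q (n - i)), by simp [hi.ne'], ?_⟩
      rw [quad, Finset.sum_eq_single i]
      · rw [Pi.single_eq_same, uHat_eq, uHat_eq, smul_mul_smul_comm, smul_smul]
        have h1 := uDenom_ne_zero_of_le hi.le hn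
        have h2 := uDenom_ne_zero_of_le (Nat.sub_le n i) hn
        rw [← mul_inv, mul_inv_cancel₀ (mul_ne_zero h1 h2), one_smul]
      · intro m _ hm
        rw [Pi.single_eq_of_ne hm, zero_smul]
      · intro h
        simp at h
        omega
    | zero => exact ⟨0, rfl, by simp [quad]⟩
    | add y z _ _ hy hz =>
      obtain ⟨c, hc, rfl⟩ := hy
      obtain ⟨d, hd, rfl⟩ := hz
      exact ⟨c + d, by simp [hc, hd], by simp [quad, add_smul, Finset.sum_add_distrib]⟩
    | smul a y _ hy =>
      obtain ⟨c, hc, rfl⟩ := hy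
      exact ⟨a • c, by simp [hc], by simp [quad, Finset.smul_sum, smul_smul]⟩
  · rintro ⟨c, hc, rfl⟩
    rw [quad, Finset.sum_range_succ, hc, zero_smul, add_zero]
    refine Submodule.sum_mem _ fun m hm => Submodule.smul_mem _ _ ?_
    rw [uHat_eq, uHat_eq, smul_mul_smul_comm]
    exact Submodule.smul_mem _ _ (Submodule.subset_span ⟨m, by simpa using hm, rfl⟩)

/-- The top coefficient is zero on `U'_n`, and `c_{m+1} + q^m q₂₁ c_m = 0` with `q^m q₂₁ ≠ 0`
propagates this downward. -/
theorem eq_zero_of_mem_U'_of_skewDer_eq_zero (h00 : Q 0 0 ≠ 0) (h10 : Q 1 0 ≠ 0) {n : ℕ}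
    (hn : uDenom Q n ≠ 0) {y : T k} (hy : y ∈ U' Q n) (hd : skewDer Q 0 y = 0) : y = 0 := by
  obtain ⟨c, hc, rfl⟩ := (mem_U'_iff hn).1 hy
  cases n with
  | zero => simp [quad, hc]
  | succ n =>
    rw [skewDer_zero_quad hn] at hd
    have h : ∀ d, c (n + 1 - d) = 0 := by
      intro d
      induction d with
      | zero => exact hc
      | succ d ih =>
        rcases Nat.lt_or_ge n d with hd' | hd'
        · rwa [show n + 1 - (d + 1) = n + 1 - d by omega]
        · have h1 := quad_eq_zero (uDenom_ne_zero_of_le n.le_succ hn) hd (Nat.sub_le n d)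
          rw [derCoeff, show n - d + 1 = n + 1 - d by omega, ih, zero_add] at h1
          rw [Nat.add_sub_add_right]
          exact (mul_eq_zero.1 h1).resolve_left (mul_ne_zero (pow_ne_zero _ h00) h10)
    refine Finset.sum_eq_zero fun m hm => ?_
    have h1 := h (n + 1 - m)
    rw [Nat.sub_sub_self (by simpa [Nat.lt_succ_iff] using hm)] at h1
    rw [h1, zero_smul]

theorem adx_mem_radicalSubmodule (i : Fin 2) {y : T k} (hy : y ∈ radicalSubmodule Q) :
    adx Q i y ∈ radicalSubmodule Q :=
  Submodule.sub_mem _ (mul_mem_radicalSubmodule _ hy).1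
    (mul_mem_radicalSubmodule _ (scale_mem_radicalSubmodule _ hy)).2

theorem adx_pow_mem_radicalSubmodule (i : Fin 2) (t : ℕ) {y : T k}
    (hy : y ∈ radicalSubmodule Q) : (adx Q i ^ t) y ∈ radicalSubmodule Q := by
  induction t with
  | zero => exact hy
  | succ t ih => rw [pow_succ']; exact adx_mem_radicalSubmodule i ih

theorem quad_mem_radicalSubmodule {l : ℕ} {c : ℕ → k}
    (h0 : skewDer Q 0 (quad Q l c) ∈ radicalSubmodule Q)
    (h1 : c 0 + Q 0 1 ^ l * Q 1 1 * c l = 0) : quad Q l c ∈ radicalSubmodule Q := by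
  rw [mem_radicalSubmodule_iff_skewDer]
  refine ⟨pairing_nil_quad l c, fun i => ?_⟩
  fin_cases i
  · exact h0
  · have h : skewDer Q 1 (quad Q l c) = 0 := by rw [skewDer_one_quad, h1, zero_smul]
    exact h ▸ Submodule.zero_mem _

/-- Here `d₁(P_j) = 0`, and `h` says that the two end terms of `d₂(P_j)` cancel. -/
theorem P_mem_radicalSubmodule {j : ℕ} (hj : uDenom Q j ≠ 0)
    (h : Q 0 0 ^ (j * (j - 1) / 2) * (-(Q 0 1 * Q 1 0)) ^ j * Q 1 1 = -1) :
    P Q j ∈ radicalSubmodule Q := by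
  rw [P_eq_quad 0]
  refine quad_mem_radicalSubmodule ?_ ?_
  · cases j with
    | zero => simp [quad, skewDer_mul, skewDer_zero_uHat_zero]
    | succ j =>
      rw [skewDer_zero_quad hj, quad, Finset.sum_eq_zero]
      · exact Submodule.zero_mem _
      · intro m hm
        rw [derCoeff_adCoeff_zero _ _ _ _ _ (by simpa using hm), zero_smul]
  · simp only [adCoeff, if_pos, Nat.zero_le, le_refl]
    rw [← mul_neg, mul_pow] at h
    simp
    linear_combination h

/-- The recursion for `a` is solved upward from `a 0 = 0`; pairing it with `e` telescopes to a
nonzero multiple of `a (l + 1)`, so `hc` forces this to vanish. -/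
theorem exists_mem_U' (h00 : Q 0 0 ≠ 0) (h10 : Q 1 0 ≠ 0) {l : ℕ} (hl : uDenom Q (l + 1) ≠ 0)
    (e c : ℕ → k) (he : ∀ m, e m = -(Q 0 0 ^ (m + 1) * Q 1 0) * e (m + 1)) (he0 : ∀ m, e m ≠ 0)
    (hc : ∑ m ∈ Finset.range (l + 1), e m * c m = 0) :
    ∃ a : ℕ → k, a 0 = 0 ∧ a (l + 1) = 0 ∧
      skewDer Q 0 (quad Q (l + 1) a) = (-Q 1 0) • quad Q l c := by
  let a : ℕ → k := fun n =>
    n.rec 0 fun m b => -(Q 1 0 * c m) - Q 0 0 ^ m * Q 1 0 * b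
  have ha : ∀ m, derCoeff (Q 0 0) (Q 1 0) a m = -Q 1 0 * c m := by
    intro m
    have : a (m + 1) = -(Q 1 0 * c m) - Q 0 0 ^ m * Q 1 0 * a m := rfl
    rw [derCoeff, this]
    ring
  refine ⟨a, rfl, ?_, ?_⟩
  · have h := sum_mul_derCoeff (Q 0 0) (Q 1 0) e a he (l + 1)
    have h' : ∑ m ∈ Finset.range (l + 1), e m * derCoeff (Q 0 0) (Q 1 0) a m = 0 := by
      rw [← mul_zero (-Q 1 0), ← hc, Finset.mul_sum]
      exact Finset.sum_congr rfl fun m _ => by rw [ha]; ring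
    rw [h', show a 0 = 0 from rfl, mul_zero, zero_sub, eq_comm, neg_eq_zero] at h
    exact (mul_eq_zero.1 h).resolve_left
      (mul_ne_zero (mul_ne_zero (pow_ne_zero _ h00) h10) (he0 _))
  · rw [skewDer_zero_quad hl, quad, quad, Finset.smul_sum]
    exact Finset.sum_congr rfl fun m _ => by rw [ha, smul_smul]

end Elements

end RankTwo

end

/-! ### Existence and uniqueness of `L_n`. -/

theorem mainTheorem7 {k : Type*} [Field k] (p : ℕ) (hp : p.Prime) [CharP k p]
    (Q : Matrix (Fin 2) (Fin 2) k) (hQ : ∀ i j, Q i j ≠ 0)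
    (q r s : k) (hq : q = Q 0 0) (hr : r = Q 0 1 * Q 1 0) (hs : s = Q 1 1)
    (n : ℕ) (hn : RankTwo.qFact q n * RankTwo.bProd q r n ≠ 0)
    (hnJ : n ∈ RankTwo.J₂ p q r s)
    (j : ℕ) (hj : j ∈ RankTwo.J₁ q r s) (hjn : j < n) (hqr : q ^ (n + j - 1) * r ^ 2 = 1) :
    ∃! L : RankTwo.T k, L ∈ RankTwo.U' Q n ∧ RankTwo.nicholsMap Q L = 0 ∧
      (-(Q 1 0)⁻¹) • RankTwo.skewDer Q 0 L =
        (RankTwo.adx Q 0 ^ (n - j - 1)) (RankTwo.P Q j) := by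
  open RankTwo in
  subst hq hr hs
  replace hn : uDenom Q n ≠ 0 := hn
  obtain ⟨t, rfl⟩ : ∃ t, n = j + t + 1 := ⟨n - j - 1, by omega⟩
  have hinJ : InJ (Q 0 0) (Q 0 1 * Q 1 0) (Q 1 1) (j + t + 1) := hnJ.1
  rw [InJ] at hinJ
  have hJ := hinJ.2 j hjn hj.1
  rw [show j + t + 1 - j = t + 1 by omega, show j + (j + t + 1) - 1 = 2 * j + t by omega,
    qNum_eq_qInt, qNum_eq_qInt] at hJ
  rw [show j + t + 1 - j - 1 = t by omega, adx_pow_P (uDenom_ne_zero_of_le (by omega) hn)]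
  have hden : ∀ m < j + t + 1,
      qInt (Q 0 0) (m + 1) ≠ 0 ∧ 1 - Q 0 0 ^ m * (Q 0 1 * Q 1 0) ≠ 0 := by
    intro m hm
    have h := uDenom_ne_zero_of_le (Nat.succ_le_of_lt hm) hn
    rw [Nat.succ_eq_add_one, uDenom_succ] at h
    exact mul_ne_zero_iff.1 (right_ne_zero_of_mul h)
  -- The solution of the telescoping recursion `he` with `e 0 = 1`.
  let e : ℕ → k := fun m => (-Q 1 0)⁻¹ ^ m * (Q 0 0)⁻¹ ^ (m * (m - 1) / 2 + m)
  have he : ∀ m, e m = -(Q 0 0 ^ (m + 1) * Q 1 0) * e (m + 1) := by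
    intro m
    simp only [e, succ_mul_self_half]
    have h00 := hQ 0 0
    have h10 := hQ 1 0
    rw [pow_succ (-Q 1 0)⁻¹, pow_add (Q 0 0)⁻¹ (_ + m), inv_pow (Q 0 0) (m + 1)]
    field_simp
  have he0 : ∀ m, e m ≠ 0 := fun m => mul_ne_zero
    (pow_ne_zero _ (inv_ne_zero (neg_ne_zero.2 (hQ 1 0))))
    (pow_ne_zero _ (inv_ne_zero (hQ 0 0)))
  -- The condition of `J` for the pair `j < n` supplies the vanishing quantum number; `1 -
  -- q^{(2j+t)/2} r` is a factor of `b_n ≠ 0`.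
  have hsum := sum_mul_adCoeff_eq_zero (Q 0 0) (Q 0 1) (Q 1 0) e he j t (hden t (by omega)).1
    hJ.1 fun h => ⟨hJ.2 h, (hden _ (by omega)).2⟩
  obtain ⟨a, ha0, ha1, had⟩ := exists_mem_U' (hQ 0 0) (hQ 1 0) hn e _ he he0 hsum
  have hneg : (-(Q 1 0)⁻¹) * (-Q 1 0) = 1 := by
    rw [neg_mul_neg, inv_mul_cancel₀ (hQ 1 0)]
  refine ⟨quad Q (j + t + 1) a, ⟨(mem_U'_iff hn).2 ⟨a, ha1, rfl⟩, ?_, ?_⟩, ?_⟩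
  · refine nicholsMap_eq_zero_of_mem_radicalSubmodule
      (quad_mem_radicalSubmodule ?_ (by rw [ha0, ha1]; ring))
    rw [had, ← adx_pow_P (uDenom_ne_zero_of_le (by omega) hn)]
    exact Submodule.smul_mem _ _ (adx_pow_mem_radicalSubmodule 0 t
      (P_mem_radicalSubmodule (uDenom_ne_zero_of_le hjn.le hn) hj.2.1))
  · rw [had, smul_smul, hneg, one_smul]
  -- Injectivity of `d₁` on `U'_n` suffices; the kernel condition plays no role here.
  · rintro L ⟨hL, -, hLd⟩
    refine sub_eq_zero.1 (eq_zero_of_mem_U'_of_skewDer_eq_zero (hQ 0 0) (hQ 1 0) hn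
      (Submodule.sub_mem _ hL ((mem_U'_iff hn).2 ⟨a, ha1, rfl⟩)) ?_)
    rw [map_sub, had, ← hLd, smul_smul, mul_comm, hneg, one_smul, sub_self]
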